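/- **Model.** There are $N\ge 2$ users (indices cyclic, $i\pm1$ modulo $N$), $T\ge 1$ time slots and $L$ linear constraints. User $i$ has utility $\sum_t v^i_t(x^i_t)$ for the demand $x^i=(x^i_t)_t$. Given are unit prices $p_t\in\mathbb R$, a unit peak price $p_0\in\mathbb R$, a matrix $A=(a^{i,l}_t)\in\mathbb R^{L\times NT}$ and $b\in\mathbb R^L$, $b\ge 0$, such that $\mathcal X=\{x\in\mathbb R^{NT}: Ax\le b\}$ is bounded. The problem is to maximize $f(x)-p_0w$, where $f(x)=\sum_{i,t}\big(v^i_t(x^i_t)-p_tx^i_t\big)$, over $(x,w)$ subject to $Ax\le b$ and $\sum_i x^i_t\le w$ for all $t$. An *optimal price vector* is a solution $(\lambda,\mu)\in\mathbb R^L\times\mathbb R^T$ of its Lagrangian dual: it minimizes $\sup_{x,w}\{f(x)-p_0w-\sum_l\lambda^l((Ax)_l-b^l)-\sum_t\mu_t(\sum_ix^i_t-w)\}$ over $(\lambda,\mu)\ge 0$. Let $\tilde A=\binom{A}{\mathbf 1_N^{\mathsf T}\otimes I_T}$, with spectral norm $\|\tilde A\|$. **Assumptions.** For some $\delta>0$ every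 $v^i_t:\mathbb R\to\mathbb R\cup\{-\infty\}$ is finite exactly on an open interval (possibly $\mathbb R$), and is twice differentiable and $\delta$-strongly concave there. There are $\underline r^i_t,\bar r^i_t\in\mathbb R$ such that for every $x\in\mathcal X$ the marginal utility $\dot v^i_t(x^i_t)$ exists and lies in $[\underline r^i_t,\bar r^i_t]$, and every $r\in[\underline r^i_t,\bar r^i_t]$ equals $\dot v^i_t(x)$ for some $x$. Let $$\mathcal P=\{\tilde\lambda=(\lambda,\mu)\ge0:\ \underline r^i_t\le(\tilde A^{\mathsf T}\tilde\lambda)^i_t+p_t\le\bar r^i_t\ \ \forall i,t,\ \ \textstyle\sum_t\mu_t=p_0\}.$$ **Mechanism.** User $i$ sends $m^i=(y^i,q^i,s^i,\beta^i)\in\mathbb R^T\times\mathbb R^L_{\ge0}\times\mathbb R^T_{\ge0}\times\mathbb R^T$, receives the demand $y^i$ and has payoff $\sum_tv^i_t(y^i_t)-\hat t^i(m)$ with tax $$\hat t^i(m)=\sum_t(p_t+\mathcal{RP}_t(s^{-i},\zeta^{-i}))y^i_t+\sum_{l}q^{-i,l}\sum_ta^{i,l}_ty^i_t+\sum_t(\beta^i_t-y^{i+1}_t)^2$$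 $$+\sum_l\Big[(q^{i,l}-q^{-i,l})^2+q^{i,l}\Big(b^l-\sum_{j\ne i}\sum_ta^{j,l}_ty^j_t-\sum_ta^{i,l}_t\beta^{i-1}_t\Big)\Big]+\sum_t\big[(s^i_t-s^{-i}_t)^2+s^i_t(\max_{t'}\zeta^{-i}_{t'}-\zeta^{-i}_t)\big],$$ where $q^{-i,l},s^{-i}_t$ are the averages of $q^{j,l},s^j_t$ over $j\ne i$, $\zeta^{-i}_t=\sum_{j\ne i}y^j_t+\beta^{i-1}_t$, and $\mathcal{RP}_t(s,\zeta)=p_0s_t/\sum_{t'}s_{t'}$ if $s\ne0$, while $\mathcal{RP}(0,\zeta)$ divides $p_0$ equally among the maximizers of $t\mapsto\zeta_t$ and is $0$ at the other $t$. NE means pure Nash equilibrium of the resulting game. **Learning algorithm** (initial prices $(q^0,s^0)\in\mathcal P$, step size $\alpha$, at most $K$ iterations). Put $(q^i(0),s^i(0))=(q^0,s^0)$ for all $i$, and always $y^i_t(k)=(\dot v^i_t)^{-1}\big(p_t+\sum_la^{i,l}_tq^{i,l}(k)+s^i_t(k)\big)$. In each iteration, for each user $i$, $$(q^i(k+1),s^i(k+1))=\mathrm{Proj}_{\mathcal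 P}\Big(\big(q^{i,l}(k)-\alpha(b^l-(Ay(k))_l)\big)_l,\ \big(s^i_t(k)+\alpha\textstyle\sum_jy^j_t(k)\big)_t\Big),$$ with $\mathrm{Proj}_{\mathcal P}$ the Euclidean projection, stopping early if an iteration changes nothing. The output $m(K)$ consists of the last $y,q,s$ and $\beta^i=y^{i+1}$. **Theorem.** Let $f$ be $\delta'$-strongly concave on its domain, $\delta'>0$, and let $0<\alpha<2\delta'/\|\tilde A\|^2$. Then, for every user $i$ and every optimal price vector $(q^*,s^*)$, the Euclidean distance from the price vector $(q^i(K),s^i(K))$ to $(q^*,s^*)$ is non-increasing in $K$. Furthermore, $\lim_{K\to\infty}m(K)=m^*$ for some NE $m^*$, in which all users announce one and the same price vector, and this is an optimal price vector. -/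

import Mathlib

open scoped Matrix

/-- The data of an energy community with `N` users, `T` time slots and `L` linear constraints.
The utility of user `i` at time `t` is the extended-valued function that equals `v i t` on its
effective domain `dom i t` and `-∞` outside it (`dom i t = Set.univ` is the everywhere finite
case). The unit prices are `p`, the unit peak price is `p0`, and the feasible set of demands is
`{x | A x ≤ b}`. -/
structure EnergyCommunity (N T L : ℕ) where
  v : Fin N → Fin T → ℝ → ℝ
  dom : Fin N → Fin T → Set ℝ
  p : Fin T → ℝ
  p0 : ℝ
  A : Matrix (Fin L) (Fin N × Fin T) ℝ
  b : Fin L → ℝ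

/-- Demand vectors `x = (x i t)`, with the Euclidean norm. -/
abbrev Alloc (N T : ℕ) := EuclideanSpace ℝ (Fin N × Fin T)

/-- Price vectors `(λ, μ)`: one price per constraint (`Sum.inl l`), one peak price per time slot
(`Sum.inr t`), with the Euclidean norm. -/
abbrev Price (T L : ℕ) := EuclideanSpace ℝ (Fin L ⊕ Fin T)

/-- A message of one user: demand `y`, constraint prices `q`, peak prices `s`, and the proxy `β`
for the demand of the next user. -/
abbrev Msg (T L : ℕ) := (Fin T → ℝ) × (Fin L → ℝ) × (Fin T → ℝ) × (Fin T → ℝ)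

namespace Msg

variable {T L : ℕ}

def y (m : Msg T L) : Fin T → ℝ := m.1
def q (m : Msg T L) : Fin L → ℝ := m.2.1
def s (m : Msg T L) : Fin T → ℝ := m.2.2.1
def β (m : Msg T L) : Fin T → ℝ := m.2.2.2

/-- The message space: suggested prices are nonnegative. -/
def Admissible (m : Msg T L) : Prop := (∀ l, 0 ≤ m.q l) ∧ ∀ t, 0 ≤ m.s t

end Msg

/-- Message profiles, with the product topology. -/
abbrev Profile (N T L : ℕ) := Fin N → Msg T L

/-- The state of the learning algorithm: each user's suggested price vector and demand. -/
structure LearnState (N T L : ℕ) where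
  price : Fin N → Price T L
  demand : Fin N → Fin T → ℝ

/-- The Euclidean projection onto `S`, i.e. the point of `S` nearest to `x` (for the nonempty closed
convex sets to which it is applied this point exists and is unique). -/
noncomputable def euclideanProj {E : Type*} [NormedAddCommGroup E] (S : Set E) (x : E) : E :=
  Classical.epsilon fun z => z ∈ S ∧ ∀ z' ∈ S, dist x z ≤ dist x z'

namespace EnergyCommunity

variable {N T L : ℕ} (C : EnergyCommunity N T L)

/-! ### The demand management problem and its dual -/

/-- The feasible set `{x | A x ≤ b}`. -/
def feasible : Set (Alloc N T) := {x | ∀ l, (C.A *ᵥ x.ofLp) l ≤ C.b l}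

/-- The demand vectors at which all utilities are finite. -/
def allocDom : Set (Alloc N T) := {x | ∀ i t, x (i, t) ∈ C.dom i t}

/-- The utilities minus the energy cost without the peak charge. -/
def objective (x : Alloc N T) : ℝ := ∑ i, ∑ t, (C.v i t (x (i, t)) - C.p t * x (i, t))

/-- The Lagrangian of: maximize `objective x - p0 * w` subject to `A x ≤ b` and
`∑ i, x i t ≤ w` for all `t`. -/
def lagrangian (π : Price T L) (x : Alloc N T) (w : ℝ) : ℝ :=
  C.objective x - C.p0 * w - ∑ l, π (Sum.inl l) * ((C.A *ᵥ x.ofLp) l - C.b l)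
    - ∑ t, π (Sum.inr t) * (∑ i, x (i, t) - w)

/-- The dual function. -/
noncomputable def dual (π : Price T L) : EReal :=
  ⨆ x ∈ C.allocDom, ⨆ w : ℝ, (C.lagrangian π x w : EReal)

/-- An optimal price vector: a solution of the dual problem, minimize `dual` over `π ≥ 0`. -/
def IsOptimalPrice (π : Price T L) : Prop :=
  (∀ j, 0 ≤ π j) ∧ ∀ π' : Price T L, (∀ j, 0 ≤ π' j) → C.dual π ≤ C.dual π'

/-- The matrix `Ã` of all constraints: `A` stacked on `1ᵀ ⊗ I`. -/
def Atilde : Matrix (Fin L ⊕ Fin T) (Fin N × Fin T) ℝ :=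
  Matrix.fromRows C.A (Matrix.of fun t j => if j.2 = t then 1 else 0)

/-- The spectral norm of `Ã`. -/
noncomputable def normAtilde : ℝ :=
  ‖LinearMap.toContinuousLinearMap (Matrix.toEuclideanLin C.Atilde)‖

/-! ### Assumptions -/

/-- The utilities are twice differentiable and `δ`-strongly concave on their open domains, and the
feasible set is a polytope `{x | A x ≤ b}` with `b ≥ 0`. -/
structure Standing (δ : ℝ) : Prop where
  isOpen_dom : ∀ i t, IsOpen (C.dom i t)
  differentiable : ∀ i t, DifferentiableOn ℝ (C.v i t) (C.dom i t)
  twice_differentiable : ∀ i t, DifferentiableOn ℝ (deriv (C.v i t)) (C.dom i t)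
  strongConcave : ∀ i t, StrongConcaveOn (C.dom i t) δ (C.v i t)
  b_nonneg : ∀ l, 0 ≤ C.b l
  bounded : Bornology.IsBounded C.feasible

/-- The numbers `rlo i t`, `rhi i t` bound the marginal utilities over the feasible set (where the
utilities are in particular finite), and every number between them is a marginal utility. -/
structure PriceBounds (rlo rhi : Fin N → Fin T → ℝ) : Prop where
  mem_Icc : ∀ x ∈ C.feasible, ∀ i t,
    x (i, t) ∈ C.dom i t ∧ deriv (C.v i t) (x (i, t)) ∈ Set.Icc (rlo i t) (rhi i t)
  exists_eq : ∀ i t, ∀ r ∈ Set.Icc (rlo i t) (rhi i t), ∃ x ∈ C.dom i t, deriv (C.v i t) x = r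

/-- The set `𝒫` of proper prices. -/
def properPrices (rlo rhi : Fin N → Fin T → ℝ) : Set (Price T L) :=
  {π | (∀ j, 0 ≤ π j) ∧
    (∀ i t, (C.Atildeᵀ *ᵥ π.ofLp) (i, t) + C.p t ∈ Set.Icc (rlo i t) (rhi i t)) ∧
    ∑ t, π (Sum.inr t) = C.p0}

/-! ### The mechanism and its game; the successor of user `i` is `finRotate N i` -/

/-- `s^{-i}`: the average of the peak prices suggested by the other users. -/
noncomputable def sOthers (m : Profile N T L) (i : Fin N) (t : Fin T) : ℝ :=
  (∑ j ∈ Finset.univ.erase i, (m j).s t) / ((N : ℝ) - 1)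

/-- `q^{-i}`: the average of the constraint prices suggested by the other users. -/
noncomputable def qOthers (m : Profile N T L) (i : Fin N) (l : Fin L) : ℝ :=
  (∑ j ∈ Finset.univ.erase i, (m j).q l) / ((N : ℝ) - 1)

/-- The proxy for user `i`'s demand, announced by her predecessor. -/
def proxy (m : Profile N T L) (i : Fin N) : Fin T → ℝ := (m ((finRotate N).symm i)).β

/-- `ζ^{-i}`: total demand, with user `i`'s own demand replaced by the proxy. -/
def zeta (m : Profile N T L) (i : Fin N) (t : Fin T) : ℝ :=
  ∑ j ∈ Finset.univ.erase i, (m j).y t + proxy m i t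

open Classical in
/-- The radial pricing operator. -/
noncomputable def radialPrice (s y : Fin T → ℝ) (t : Fin T) : ℝ :=
  if s ≠ 0 then s t / (∑ t', s t') * C.p0
  else if ∀ t', y t' ≤ y t then
    C.p0 / ((Finset.univ.filter fun u : Fin T => ∀ t', y t' ≤ y u).card : ℝ)
  else 0

/-- The tax of user `i`; the demand allocated to user `j` is her announcement `(m j).y`. -/
noncomputable def tax (m : Profile N T L) (i : Fin N) : ℝ :=
  (∑ t, (C.p t + C.radialPrice (sOthers m i) (zeta m i) t) * (m i).y t
      + ∑ l, qOthers m i l * ∑ t, C.A l (i, t) * (m i).y t)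
    + ∑ t, ((m i).β t - (m (finRotate N i)).y t) ^ 2
    + ∑ l, (((m i).q l - qOthers m i l) ^ 2
        + (m i).q l * (C.b l - ∑ j ∈ Finset.univ.erase i, ∑ t, C.A l (j, t) * (m j).y t
            - ∑ t, C.A l (i, t) * proxy m i t))
    + ∑ t, (((m i).s t - sOthers m i t) ^ 2
        + (m i).s t * ((⨆ t', zeta m i t') - zeta m i t))

open Classical in
/-- The payoff of user `i`: utility of the allocated demand minus tax, and `-∞` if the utility is
`-∞`. -/
noncomputable def payoff (m : Profile N T L) (i : Fin N) : EReal :=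
  if ∀ t, (m i).y t ∈ C.dom i t then
    ((∑ t, C.v i t ((m i).y t) - C.tax m i : ℝ) : EReal)
  else ⊥

/-- (Pure) Nash equilibria of the game induced by the mechanism. -/
def IsNash (m : Profile N T L) : Prop :=
  (∀ i, (m i).Admissible) ∧
    ∀ i, ∀ m' : Msg T L, m'.Admissible → C.payoff (Function.update m i m') i ≤ C.payoff m i

/-! ### The learning algorithm -/

/-- User `i`'s demand at time `t` under the price vector `π`: the inverse of the marginal utility
at the aggregated price. -/
noncomputable def demandAt (π : Price T L) (i : Fin N) (t : Fin T) : ℝ :=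
  Function.invFunOn (deriv (C.v i t)) (C.dom i t)
    (C.p t + ∑ l, C.A l (i, t) * π (Sum.inl l) + π (Sum.inr t))

/-- The state in which the users suggest the given prices and announce the demand at them. -/
noncomputable def stateOf (π : Fin N → Price T L) : LearnState N T L :=
  ⟨π, fun i t => C.demandAt (π i) i t⟩

/-- User `i`'s price vector after the gradient step and before the projection. -/
noncomputable def tentativePrice (α : ℝ) (S : LearnState N T L) (i : Fin N) : Price T L :=
  WithLp.toLp 2 (Sum.elim
    (fun l => S.price i (Sum.inl l)
      - α * (C.b l - ∑ j, ∑ t, C.A l (j, t) * S.demand j t))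
    (fun t => S.price i (Sum.inr t) + α * ∑ j, S.demand j t))

/-- One iteration of the algorithm with price set `P` and step size `α`. -/
noncomputable def learnStep (P : Set (Price T L)) (α : ℝ) (S : LearnState N T L) :
    LearnState N T L :=
  C.stateOf fun i => euclideanProj P (C.tentativePrice α S i)

open Classical in
/-- The loop: at most the given number of iterations, stopped after an iteration that changes
nothing. -/
noncomputable def learnLoop (P : Set (Price T L)) (α : ℝ) :
    ℕ → LearnState N T L → LearnState N T L
  | 0, S => S
  | k + 1, S =>
    if C.learnStep P α S = S then C.learnStep P α S
    else learnLoop P α k (C.learnStep P α S)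

/-- The final state of the algorithm run for `K` iterations from the common initial prices `π₀`. -/
noncomputable def learnRun (P : Set (Price T L)) (α : ℝ) (π₀ : Price T L) (K : ℕ) :
    LearnState N T L :=
  C.learnLoop P α K (C.stateOf fun _ => π₀)

/-- The message profile `m(K)` returned by the algorithm. -/
noncomputable def learnProfile (P : Set (Price T L)) (α : ℝ) (π₀ : Price T L) (K : ℕ) :
    Profile N T L := fun i =>
  ((C.learnRun P α π₀ K).demand i,
    fun l => (C.learnRun P α π₀ K).price i (Sum.inl l),
    fun t => (C.learnRun P α π₀ K).price i (Sum.inr t),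
    (C.learnRun P α π₀ K).demand (finRotate N i))

end EnergyCommunity

/-! All users start from the same price and apply the same update, so the algorithm is a single
iteration `π ↦ Proj_P (π - α (c - B y(π)))` on price vectors, with `B = Ã`, `c = (b, 0)` and `y(π)`
the demand at prices `π`. This is projected gradient descent on the dual, restricted to the proper
prices.

Optimal prices are tied to this iteration by the KKT conditions. A maximizer of the primal problem
exists by compactness, and Farkas' lemma supplies its multipliers (`exists_isKKT`). By strong
duality every optimal price satisfies KKT with that same demand `x` (`of_isOptimalPrice`). Pairing
`c - B x` with a proper price gives a nonnegative slack sum minus the constant `p0 * peak x`.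
Complementary slackness is therefore the variational inequality `0 ≤ ⟪c - B x, z - π⟫` on `P`.

Strong concavity of `f` makes the demand cocoercive: `⟪B (y π - y ρ), π - ρ⟫ ≤ -δ' ‖y π - y ρ‖²`.
For `α < 2δ'/‖B‖²` each step then brings the price no farther from any solution, and the decrease of
the squared distance controls `‖y π - x‖²`. Hence demands converge to `x`; a cluster point of the
prices is again a solution, and monotone distance to it turns subsequential into full convergence.

At a KKT pair, if the others announce its prices and demands, a user's tax splits into a linear cost
of her own demand and penalties minimized by agreeing. Agreement is thus a Nash equilibrium
(`IsKKT.isNash`). -/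

open Filter Topology
open scoped RealInnerProductSpace

/-! ### Farkas' lemma -/

/-- **Farkas' lemma** for finitely many linear functionals. -/
theorem farkas_of_finset {V ι : Type*} [AddCommGroup V] [Module ℝ V] (s : Finset ι)
    (a : ι → V →ₗ[ℝ] ℝ) (c : V →ₗ[ℝ] ℝ)
    (h : ∀ d, (∀ i ∈ s, a i d ≤ 0) → c d ≤ 0) :
    ∃ r : ι → ℝ, (∀ i, 0 ≤ r i) ∧ (∀ i ∉ s, r i = 0) ∧ c = ∑ i ∈ s, r i • a i := by
  classical
  induction s using Finset.induction_on generalizing a c with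
  | empty =>
    refine ⟨0, by simp, by simp, ?_⟩
    ext d
    have h₁ := h d (by simp)
    have h₂ := h (-d) (by simp)
    simp only [map_neg, Finset.sum_empty, LinearMap.zero_apply] at *
    linarith
  | insert j s hj ih =>
    -- If the functionals in `s` already suffice, `j` gets coefficient zero. Otherwise some
    -- direction violates the conclusion, and `a j` must be positive on it. Rescaled to `a j d₀ =
    -- 1`, it defines the projection `d ↦ d - a j d • d₀` onto the kernel of `a j`, along which the
    -- induction hypothesis is applied.
    by_cases hs : ∀ d, (∀ i ∈ s, a i d ≤ 0) → c d ≤ 0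
    · obtain ⟨r, hr, hr0, hc⟩ := ih a c hs
      refine ⟨r, hr, fun i hi => hr0 i fun h => hi (Finset.mem_insert_of_mem h), ?_⟩
      rw [Finset.sum_insert hj, hr0 j hj, zero_smul, zero_add, hc]
    · push Not at hs
      obtain ⟨d₁, hd₁, hcd₁⟩ := hs
      have hj₁ : 0 < a j d₁ := by
        by_contra! hle
        exact absurd (h d₁ (by simpa [hle] using hd₁)) (not_le.2 hcd₁)
      obtain ⟨d₀, hd₀, hcd₀, hj₀⟩ : ∃ d₀, (∀ i ∈ s, a i d₀ ≤ 0) ∧ 0 < c d₀ ∧ a j d₀ = 1 := by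
        refine ⟨(a j d₁)⁻¹ • d₁, fun i hi => ?_, ?_, ?_⟩
        · rw [map_smul, smul_eq_mul]
          exact mul_nonpos_of_nonneg_of_nonpos (inv_nonneg.2 hj₁.le) (hd₁ i hi)
        · rw [map_smul, smul_eq_mul]; positivity
        · rw [map_smul, smul_eq_mul, inv_mul_cancel₀ hj₁.ne']
      obtain ⟨r, hr, hr0, hc⟩ := ih (fun i => a i - a i d₀ • a j) (c - c d₀ • a j) (by
        intro d hd
        have := h (d - a j d • d₀) (by
          intro i hi
          rcases Finset.mem_insert.1 hi with rfl | hi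
          · simp [hj₀]
          · have := hd i hi
            simp only [LinearMap.sub_apply, LinearMap.smul_apply, smul_eq_mul, map_sub,
              map_smul] at this ⊢
            linarith)
        simp only [LinearMap.sub_apply, LinearMap.smul_apply, smul_eq_mul, map_sub,
          map_smul] at this ⊢
        linarith)
      have hpos : 0 ≤ c d₀ - ∑ i ∈ s, r i * a i d₀ := by
        have : ∑ i ∈ s, r i * a i d₀ ≤ 0 :=
          Finset.sum_nonpos fun i hi => mul_nonpos_of_nonneg_of_nonpos (hr i) (hd₀ i hi)
        linarith
      refine ⟨Function.update r j (c d₀ - ∑ i ∈ s, r i * a i d₀), fun i => ?_, fun i hi => ?_, ?_⟩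
      · rcases eq_or_ne i j with rfl | hij
        · simpa using hpos
        · simpa [hij] using hr i
      · rw [Finset.mem_insert, not_or] at hi
        simpa [hi.1] using hr0 i hi.2
      · have hsum : ∑ i ∈ s, Function.update r j (c d₀ - ∑ i ∈ s, r i * a i d₀) i • a i
            = ∑ i ∈ s, r i • a i :=
          Finset.sum_congr rfl fun i hi => by
            rw [Function.update_of_ne (ne_of_mem_of_not_mem hi hj)]
        rw [Finset.sum_insert hj, hsum, Function.update_self]
        ext d
        have := LinearMap.congr_fun hc d
        simp only [LinearMap.sub_apply, LinearMap.smul_apply, smul_eq_mul, LinearMap.add_apply,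
          LinearMap.coe_sum, Finset.sum_apply, mul_sub, Finset.sum_sub_distrib] at this ⊢
        rw [sub_mul, Finset.sum_mul]
        simp only [← mul_assoc] at this ⊢
        linarith

/-! ### Euclidean projections -/

section Proj

variable {E : Type*} [NormedAddCommGroup E] [InnerProductSpace ℝ E] [CompleteSpace E]

/-- Completeness and convexity provide a nearest point, so the `epsilon` choice really is one. Its
obtuse-angle property is the only fact about projections used later. -/
theorem euclideanProj_spec {S : Set E} (hne : S.Nonempty) (hcl : IsClosed S) (hcv : Convex ℝ S)
    (x : E) : euclideanProj S x ∈ S ∧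
      ∀ z ∈ S, ⟪x - euclideanProj S x, z - euclideanProj S x⟫ ≤ 0 := by
  have hex : ∃ z, z ∈ S ∧ ∀ z' ∈ S, dist x z ≤ dist x z' := by
    obtain ⟨v, hv, hmin⟩ := exists_norm_eq_iInf_of_complete_convex hne hcl.isComplete hcv x
    refine ⟨v, hv, fun z' hz' => ?_⟩
    rw [dist_eq_norm, dist_eq_norm, hmin]
    exact ciInf_le (f := fun w : S => ‖x - w‖) ⟨0, by rintro _ ⟨w, rfl⟩; positivity⟩ ⟨z', hz'⟩
  have hs : euclideanProj S x ∈ S ∧ ∀ z' ∈ S, dist x (euclideanProj S x) ≤ dist x z' :=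
    Classical.epsilon_spec hex
  refine ⟨hs.1, (norm_eq_iInf_iff_real_inner_le_zero hcv hs.1).1 ?_⟩
  have : Nonempty S := hne.to_subtype
  refine le_antisymm (le_ciInf fun w => ?_)
    (ciInf_le (f := fun w : S => ‖x - w‖) ⟨0, by rintro _ ⟨w, rfl⟩; positivity⟩ ⟨_, hs.1⟩)
  simpa [dist_eq_norm] using hs.2 w w.2

end Proj

/-! ### Strongly concave functions lie below their tangents -/

/-- Strong concavity on the segment bounds the difference quotient at `ε` below by `f y - f x + (1 -
ε) * (m / 2 * ‖x - y‖ ^ 2)`; let `ε` decrease to 0. Only a derivative along the segment is required,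
so this serves both the single utilities and the whole objective. -/
theorem StrongConcaveOn.le_tangent {E : Type*} [NormedAddCommGroup E] [NormedSpace ℝ E]
    {s : Set E} {m : ℝ} {f : E → ℝ} (hf : StrongConcaveOn s m f) {x y : E} (hx : x ∈ s)
    (hy : y ∈ s) {g : ℝ} (hg : HasDerivAt (fun ε : ℝ => f (x + ε • (y - x))) g 0) :
    f y ≤ f x + g - m / 2 * ‖x - y‖ ^ 2 := by
  have hlim := hg.tendsto_slope_zero_right
  have hlow : Tendsto (fun ε : ℝ => f y - f x + (1 - ε) * (m / 2 * ‖x - y‖ ^ 2)) (𝓝[>] 0)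
      (𝓝 (f y - f x + (1 - 0) * (m / 2 * ‖x - y‖ ^ 2))) :=
    (Continuous.tendsto (by fun_prop) 0).mono_left nhdsWithin_le_nhds
  have hle : f y - f x + (1 - 0) * (m / 2 * ‖x - y‖ ^ 2) ≤ g := by
    refine le_of_tendsto_of_tendsto hlow hlim ?_
    filter_upwards [Ioo_mem_nhdsGT (zero_lt_one : (0 : ℝ) < 1)] with ε hε
    have h := hf.2 hx hy (sub_nonneg.2 hε.2.le) hε.1.le (by ring)
    have e : (1 - ε) • x + ε • y = x + ε • (y - x) := by module
    rw [e] at h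
    simp only [smul_eq_mul, zero_add, zero_smul, add_zero] at h ⊢
    rw [inv_mul_eq_div, le_div_iff₀ hε.1]
    nlinarith [h]
  linarith

/-! ### The projected gradient method -/

section ProjectedGradient

variable {E F : Type*} [NormedAddCommGroup E] [InnerProductSpace ℝ E]
  [NormedAddCommGroup F] [InnerProductSpace ℝ F]
  {P : Set E} {B : F →L[ℝ] E} {c : E} {y : E → F} {α δ : ℝ}

/-- One step of the projected method decreases the distance to every solution `w` of the
variational inequality. -/
theorem projectedGradient_dist_sq_le {π π' w : E} (hα : 0 < α)
    (hmono : ⟪B (y π - y w), π - w⟫ ≤ -(δ * ‖y π - y w‖ ^ 2))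
    (hproj : ⟪π - α • (c - B (y π)) - π', w - π'⟫ ≤ 0)
    (hvi : 0 ≤ ⟪c - B (y w), π' - w⟫) :
    ‖π' - w‖ ^ 2 ≤ ‖π - w‖ ^ 2 - α * (2 * δ - α * ‖B‖ ^ 2) * ‖y π - y w‖ ^ 2 := by
  set u := π - w with hu
  set d := B (y π - y w) with hd
  have hd' : B (y π) = B (y w) + d := by rw [hd, map_sub]; abel
  -- The obtuse angle at `π'`, tested against `w`, combined with the variational inequality for `w`,
  -- tested against `π'`: the fixed term `c - B (y w)` drops out.
  have key : ‖π' - w‖ ^ 2 ≤ ⟪u + α • d, π' - w⟫ := by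
    have h1 : π - α • (c - B (y π)) - π'
        = (u + α • d) - α • (c - B (y w)) - (π' - w) := by
      rw [hd', hu]; module
    have h2 : w - π' = -(π' - w) := by abel
    rw [h1, h2, inner_neg_right, inner_sub_left, inner_sub_left, real_inner_smul_left,
      real_inner_self_eq_norm_sq] at hproj
    nlinarith [mul_nonneg hα.le hvi]
  have hcs : ‖π' - w‖ ^ 2 ≤ ‖u + α • d‖ ^ 2 := by
    have h := (real_inner_le_norm (u + α • d) (π' - w))
    have : ‖π' - w‖ * ‖π' - w‖ ≤ ‖u + α • d‖ * ‖π' - w‖ := by nlinarith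
    by_cases h0 : ‖π' - w‖ = 0
    · rw [h0, zero_pow two_ne_zero]; positivity
    · have := le_of_mul_le_mul_right this (lt_of_le_of_ne (norm_nonneg _) (Ne.symm h0))
      gcongr
  have hexp : ‖u + α • d‖ ^ 2 = ‖u‖ ^ 2 + 2 * α * ⟪d, u⟫ + α ^ 2 * ‖d‖ ^ 2 := by
    rw [norm_add_sq_real, real_inner_smul_right, norm_smul, real_inner_comm, mul_pow,
      Real.norm_eq_abs, sq_abs]
    ring
  have hdn : ‖d‖ ^ 2 ≤ ‖B‖ ^ 2 * ‖y π - y w‖ ^ 2 := by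
    rw [← mul_pow]
    gcongr
    exact B.le_opNorm _
  -- The cross term contributes at most `-2αδ‖y π - y w‖²`, the square at most `α²‖B‖²‖y π - y w‖²`.
  nlinarith [mul_le_mul_of_nonneg_left hmono hα.le, mul_le_mul_of_nonneg_left hdn (sq_nonneg α)]

/-- Convergence of the projected gradient method to a solution of the variational inequality. -/
theorem projectedGradient_tendsto [ProperSpace E] (hP : IsClosed P) (hα : 0 < α) (hδ : 0 < δ)
    (hstep : α * ‖B‖ ^ 2 < 2 * δ)
    (hmono : ∀ π ∈ P, ∀ w ∈ P, ⟪B (y π - y w), π - w⟫ ≤ -(δ * ‖y π - y w‖ ^ 2))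
    {π : ℕ → E} (hmem : ∀ k, π k ∈ P)
    (hproj : ∀ k, ∀ z ∈ P, ⟪π k - α • (c - B (y (π k))) - π (k + 1), z - π (k + 1)⟫ ≤ 0)
    {w : E} (hw : w ∈ P) (hvi : ∀ z ∈ P, 0 ≤ ⟪c - B (y w), z - w⟫) :
    ∃ a ∈ P, y a = y w ∧ (∀ z ∈ P, 0 ≤ ⟪c - B (y a), z - a⟫) ∧ Tendsto π atTop (𝓝 a) ∧
      Tendsto (fun k => y (π k)) atTop (𝓝 (y a)) := by
  set κ := α * (2 * δ - α * ‖B‖ ^ 2) with hκ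
  have hκ0 : 0 < κ := mul_pos hα (by linarith)
  have fejer : ∀ w ∈ P, (∀ z ∈ P, 0 ≤ ⟪c - B (y w), z - w⟫) → ∀ k,
      ‖π (k + 1) - w‖ ^ 2 ≤ ‖π k - w‖ ^ 2 - κ * ‖y (π k) - y w‖ ^ 2 := fun w hw hvi k =>
    projectedGradient_dist_sq_le hα (hmono _ (hmem k) _ hw) (hproj k w hw) (hvi _ (hmem (k + 1)))
  have anti : ∀ w ∈ P, (∀ z ∈ P, 0 ≤ ⟪c - B (y w), z - w⟫) →
      Antitone fun k => ‖π k - w‖ ^ 2 := fun w hw hvi =>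
    antitone_nat_of_succ_le fun k => by
      have := fejer w hw hvi k
      nlinarith [mul_nonneg hκ0.le (sq_nonneg ‖y (π k) - y w‖)]
  obtain ⟨ℓ, hℓ⟩ : ∃ ℓ, Tendsto (fun k => ‖π k - w‖ ^ 2) atTop (𝓝 ℓ) :=
    ⟨_, tendsto_atTop_ciInf (anti w hw hvi) ⟨0, by rintro _ ⟨k, rfl⟩; positivity⟩⟩
  have hgap : Tendsto (fun k => ‖π k - w‖ ^ 2 - ‖π (k + 1) - w‖ ^ 2) atTop (𝓝 0) := by
    simpa using hℓ.sub (hℓ.comp (tendsto_add_atTop_nat 1))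
  have hy : Tendsto (fun k => y (π k)) atTop (𝓝 (y w)) := by
    rw [tendsto_iff_norm_sub_tendsto_zero]
    have h2 : Tendsto (fun k => ‖y (π k) - y w‖ ^ 2) atTop (𝓝 0) := by
      refine squeeze_zero (fun k => by positivity) (fun k => ?_)
        (by simpa using hgap.const_mul κ⁻¹)
      rw [inv_mul_eq_div, le_div_iff₀ hκ0]
      linarith [fejer w hw hvi k]
    simpa using h2.sqrt
  have hB : Tendsto (fun k => c - B (y (π k))) atTop (𝓝 (c - B (y w))) :=
    tendsto_const_nhds.sub ((B.continuous.tendsto _).comp hy)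
  have hbound : ∀ k, ‖π k - w‖ ≤ ‖π 0 - w‖ := fun k =>
    le_of_sq_le_sq (anti w hw hvi (Nat.zero_le k)) (norm_nonneg _)
  -- Three-point expansion around `π (k + 1)`: by the obtuse angle and the variational inequality,
  -- the cross term is bounded below by a multiple of `-‖B (y (π k)) - B (y w)‖`, which vanishes in
  -- the limit.
  have hdiff : Tendsto (fun k => π k - π (k + 1)) atTop (𝓝 0) := by
    rw [tendsto_zero_iff_norm_tendsto_zero]
    have hb : Tendsto (fun k => ‖π k - w‖ ^ 2 - ‖π (k + 1) - w‖ ^ 2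
        + 2 * α * (‖(c - B (y (π k))) - (c - B (y w))‖ * ‖π 0 - w‖)) atTop (𝓝 0) := by
      have := (tendsto_iff_norm_sub_tendsto_zero.1 hB).mul_const (‖π 0 - w‖)
      simpa using hgap.add (this.const_mul (2 * α))
    have h2 : Tendsto (fun k => ‖π k - π (k + 1)‖ ^ 2) atTop (𝓝 0) := by
      refine squeeze_zero (fun k => by positivity) (fun k => ?_) hb
      have e1 : ‖π k - w‖ ^ 2 = ‖π k - π (k + 1)‖ ^ 2
          + 2 * ⟪π k - π (k + 1), π (k + 1) - w⟫ + ‖π (k + 1) - w‖ ^ 2 := by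
        rw [← norm_add_sq_real]; congr 2; abel
      have e2 : ⟪π k - α • (c - B (y (π k))) - π (k + 1), w - π (k + 1)⟫
          = -⟪π k - π (k + 1), π (k + 1) - w⟫
            + α * (⟪(c - B (y (π k))) - (c - B (y w)), π (k + 1) - w⟫
              + ⟪c - B (y w), π (k + 1) - w⟫) := by
        rw [← inner_add_left, sub_add_cancel, ← real_inner_smul_left, ← inner_neg_left,
          ← inner_add_left, ← neg_sub (π (k + 1)) w, inner_neg_right, ← inner_neg_left]
        congr 1; abel
      have h3 := hproj k w hw
      rw [e2] at h3
      have h4 := mul_nonneg hα.le (hvi _ (hmem (k + 1)))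
      have h5 : -⟪(c - B (y (π k))) - (c - B (y w)), π (k + 1) - w⟫
          ≤ ‖(c - B (y (π k))) - (c - B (y w))‖ * ‖π 0 - w‖ :=
        (neg_le_abs _).trans ((abs_real_inner_le_norm _ _).trans
          (mul_le_mul_of_nonneg_left (hbound _) (norm_nonneg _)))
      nlinarith [mul_le_mul_of_nonneg_left h5 hα.le]
    simpa using h2.sqrt
  obtain ⟨a, -, φ, hφ, hφa⟩ := tendsto_subseq_of_bounded
    (Metric.isBounded_closedBall (x := w) (r := ‖π 0 - w‖))
    (fun k => by simpa [dist_eq_norm] using hbound k)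
  have haP : a ∈ P := hP.mem_of_tendsto hφa (Eventually.of_forall fun k => hmem _)
  have hya : y a = y w := by
    -- Cocoercivity with Cauchy–Schwarz makes `y` Lipschitz on `P`.
    have hlip : ∀ k, ‖y (π (φ k)) - y a‖ ≤ δ⁻¹ * (‖B‖ * ‖π (φ k) - a‖) := by
      intro k
      have h1 := hmono _ (hmem (φ k)) a haP
      have h2 : -⟪B (y (π (φ k)) - y a), π (φ k) - a⟫
          ≤ ‖B‖ * ‖y (π (φ k)) - y a‖ * ‖π (φ k) - a‖ :=
        (neg_le_abs _).trans ((abs_real_inner_le_norm _ _).trans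
          (mul_le_mul_of_nonneg_right (B.le_opNorm _) (norm_nonneg _)))
      rw [inv_mul_eq_div, le_div_iff₀ hδ]
      by_cases h0 : ‖y (π (φ k)) - y a‖ = 0
      · rw [h0]; simp only [zero_mul]; positivity
      · have hp := lt_of_le_of_ne (norm_nonneg _) (Ne.symm h0)
        refine le_of_mul_le_mul_left ?_ hp
        nlinarith
    have hlim : Tendsto (fun k => y (π (φ k))) atTop (𝓝 (y a)) := by
      rw [tendsto_iff_norm_sub_tendsto_zero]
      refine squeeze_zero (fun k => norm_nonneg _) hlip ?_
      simpa using ((tendsto_iff_norm_sub_tendsto_zero.1 hφa).const_mul ‖B‖).const_mul δ⁻¹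
    exact tendsto_nhds_unique hlim (hy.comp hφ.tendsto_atTop)
  have hφa' : Tendsto (fun k => π (φ k + 1)) atTop (𝓝 a) := by
    have := hφa.sub (hdiff.comp hφ.tendsto_atTop)
    simpa [Function.comp_def] using this
  -- The projection inequality tested at `w` passes to the limit along the subsequence. As `y a = y
  -- w`, both points face the same linear functional; `a` does no worse than the minimizer `w`, so
  -- it minimizes too.
  have hle : ⟪c - B (y w), a - w⟫ ≤ 0 := by
    have h1 : Tendsto (fun k => ⟪π (φ k) - π (φ k + 1) - α • (c - B (y (π (φ k)))),
        w - π (φ k + 1)⟫) atTop (𝓝 ⟪0 - α • (c - B (y w)), w - a⟫) :=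
      Tendsto.inner ((hdiff.comp hφ.tendsto_atTop).sub
        ((hB.comp hφ.tendsto_atTop).const_smul α)) (tendsto_const_nhds.sub hφa')
    have h2 : ⟪0 - α • (c - B (y w)), w - a⟫ ≤ 0 := by
      refine le_of_tendsto h1 (Eventually.of_forall fun k => ?_)
      have := hproj (φ k) w hw
      rwa [sub_right_comm] at this
    rw [zero_sub, ← neg_sub a w, inner_neg_neg, real_inner_smul_left] at h2
    nlinarith
  have hvia : ∀ z ∈ P, 0 ≤ ⟪c - B (y a), z - a⟫ := by
    intro z hz
    have : z - a = (z - w) - (a - w) := by abel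
    rw [hya, this, inner_sub_right]
    linarith [hvi z hz]
  refine ⟨a, haP, hya, hvia, ?_, hya ▸ hy⟩
  rw [tendsto_iff_norm_sub_tendsto_zero]
  have h2 : Tendsto (fun k => ‖π k - a‖ ^ 2) atTop (𝓝 0) := by
    rw [tendsto_iff_tendsto_subseq_of_antitone (anti a haP hvia) hφ.tendsto_atTop]
    simpa [Function.comp_def] using (tendsto_iff_norm_sub_tendsto_zero.1 hφa).pow 2
  simpa using h2.sqrt

end ProjectedGradient

/-! ### Stacked constraints, the Lagrangian and its directional derivatives -/

namespace EnergyCommunity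

variable {N T L : ℕ} (C : EnergyCommunity N T L)

/-- The matrix `Ã` as a continuous linear map between Euclidean spaces. -/
noncomputable def constraintCLM : Alloc N T →L[ℝ] Price T L :=
  LinearMap.toContinuousLinearMap (Matrix.toEuclideanLin C.Atilde)

/-- The right-hand side `(b, 0)` of the stacked constraints. -/
noncomputable def bound : Price T L := WithLp.toLp 2 (Sum.elim C.b 0)

/-- Total demand in slot `t`. -/
def load (x : Alloc N T) (t : Fin T) : ℝ := ∑ i, x (i, t)

/-- Peak demand. -/
noncomputable def peak (x : Alloc N T) : ℝ := ⨆ t, load x t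

theorem load_le_peak (x : Alloc N T) (t : Fin T) : load x t ≤ peak x :=
  le_ciSup (Set.finite_range _).bddAbove t

theorem peak_le (hT : 1 ≤ T) {x : Alloc N T} {w : ℝ} (h : ∀ t, load x t ≤ w) : peak x ≤ w :=
  have : Nonempty (Fin T) := ⟨⟨0, hT⟩⟩
  ciSup_le h

theorem continuous_peak (hT : 1 ≤ T) : Continuous (peak : Alloc N T → ℝ) := by
  have : Nonempty (Fin T) := ⟨⟨0, hT⟩⟩
  have h : (peak : Alloc N T → ℝ)
      = fun x => Finset.univ.sup' Finset.univ_nonempty fun t => load x t := by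
    funext x
    rw [Finset.sup'_univ_eq_ciSup]; rfl
  rw [h]
  refine Continuous.finset_sup'_apply _ fun t _ => ?_
  unfold load
  fun_prop

theorem constraintCLM_inl (x : Alloc N T) (l : Fin L) :
    C.constraintCLM x (Sum.inl l) = (C.A *ᵥ x.ofLp) l := by
  simp [constraintCLM, Atilde, Matrix.toLpLin_apply, Matrix.fromRows_mulVec]

theorem constraintCLM_inr (x : Alloc N T) (t : Fin T) :
    C.constraintCLM x (Sum.inr t) = load x t := by
  simp [constraintCLM, Atilde, Matrix.toLpLin_apply, Matrix.fromRows_mulVec, Matrix.mulVec,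
    dotProduct, load, Fintype.sum_prod_type]

theorem transpose_mulVec_apply (π : Fin L ⊕ Fin T → ℝ) (i : Fin N) (t : Fin T) :
    (C.Atildeᵀ *ᵥ π) (i, t) = ∑ l, C.A l (i, t) * π (Sum.inl l) + π (Sum.inr t) := by
  simp [Atilde, Matrix.mulVec, dotProduct]

theorem inner_price (π ρ : Price T L) :
    ⟪π, ρ⟫ = ∑ l, π (Sum.inl l) * ρ (Sum.inl l) + ∑ t, π (Sum.inr t) * ρ (Sum.inr t) := by
  simp [PiLp.inner_apply, mul_comm]

theorem inner_constraintCLM (π : Price T L) (x : Alloc N T) :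
    ⟪π, C.constraintCLM x⟫ = ∑ i, ∑ t, (C.Atildeᵀ *ᵥ π.ofLp) (i, t) * x (i, t) := by
  rw [← Fintype.sum_prod_type' (f := fun i t => (C.Atildeᵀ *ᵥ π.ofLp) (i, t) * x (i, t))]
  have : ⟪π, C.constraintCLM x⟫ = π.ofLp ⬝ᵥ (C.Atilde *ᵥ x.ofLp) := by
    simp [PiLp.inner_apply, dotProduct, constraintCLM, Matrix.toLpLin_apply, mul_comm]
  rw [this, Matrix.dotProduct_mulVec, Matrix.mulVec_transpose]
  rfl

/-- Isolates the dependence on `w`, which is linear: a finite dual value forces the peak prices to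
sum to `p0`. -/
theorem lagrangian_eq (π : Price T L) (x : Alloc N T) (w : ℝ) :
    C.lagrangian π x w = C.objective x - ⟪π, C.constraintCLM x⟫
      + ∑ l, π (Sum.inl l) * C.b l + (∑ t, π (Sum.inr t) - C.p0) * w := by
  rw [inner_price]
  simp only [lagrangian, constraintCLM_inl, constraintCLM_inr, mul_sub, Finset.sum_sub_distrib,
    ← Finset.sum_mul, load]
  ring

theorem lagrangian_eq_slack (π : Price T L) (x : Alloc N T) (w : ℝ) :
    C.lagrangian π x w = C.objective x - C.p0 * w
      + ∑ l, π (Sum.inl l) * (C.b l - (C.A *ᵥ x.ofLp) l)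
      + ∑ t, π (Sum.inr t) * (w - load x t) := by
  simp only [lagrangian, mul_sub, Finset.sum_sub_distrib, load]
  ring

/-- The derivative of the objective at `x` in direction `d`. -/
noncomputable def objectiveDeriv (x d : Alloc N T) : ℝ :=
  ∑ i, ∑ t, (deriv (C.v i t) (x (i, t)) - C.p t) * d (i, t)

variable {C} {δ δ' : ℝ} {rlo rhi : Fin N → Fin T → ℝ}

theorem Standing.hasDerivAt_v (hC : C.Standing δ) {i : Fin N} {t : Fin T} {z : ℝ}
    (hz : z ∈ C.dom i t) : HasDerivAt (C.v i t) (deriv (C.v i t) z) z :=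
  ((hC.differentiable i t).differentiableAt ((hC.isOpen_dom i t).mem_nhds hz)).hasDerivAt

theorem Standing.hasDerivAt_objective (hC : C.Standing δ) {x : Alloc N T} (hx : x ∈ C.allocDom)
    (d : Alloc N T) :
    HasDerivAt (fun ε : ℝ => C.objective (x + ε • d)) (C.objectiveDeriv x d) 0 := by
  unfold objective objectiveDeriv
  refine HasDerivAt.fun_sum fun i _ => HasDerivAt.fun_sum fun t _ => ?_
  have hlin : HasDerivAt (fun ε : ℝ => x (i, t) + ε * d (i, t)) (d (i, t)) 0 := by
    simpa using ((hasDerivAt_id (0 : ℝ)).mul_const (d (i, t))).const_add (x (i, t))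
  have hv : HasDerivAt (C.v i t) (deriv (C.v i t) (x (i, t))) (x (i, t) + 0 * d (i, t)) := by
    simpa using hC.hasDerivAt_v (hx i t)
  have := (hv.comp (0 : ℝ) hlin).sub (hlin.const_mul (C.p t))
  rw [sub_mul]
  exact this

theorem Standing.v_le_tangent (hC : C.Standing δ) {i : Fin N} {t : Fin T} {x z : ℝ}
    (hx : x ∈ C.dom i t) (hz : z ∈ C.dom i t) :
    C.v i t z ≤ C.v i t x + deriv (C.v i t) x * (z - x) - δ / 2 * (x - z) ^ 2 := by
  have h := (hC.strongConcave i t).le_tangent hx hz (g := deriv (C.v i t) x * (z - x)) (by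
    have hlin : HasDerivAt (fun ε : ℝ => x + ε • (z - x)) (z - x) 0 := by
      simpa using ((hasDerivAt_id (0 : ℝ)).mul_const (z - x)).const_add x
    have hv : HasDerivAt (C.v i t) (deriv (C.v i t) x) (x + (0 : ℝ) • (z - x)) := by
      simpa using hC.hasDerivAt_v hx
    exact hv.comp (0 : ℝ) hlin)
  rwa [Real.norm_eq_abs, sq_abs] at h

/-- Adding the tangent inequalities at two points with equal slope leaves `δ * (x - z) ^ 2 ≤ 0`.
Demand at a given price is therefore unique. -/
theorem Standing.injOn_deriv (hC : C.Standing δ) (hδ : 0 < δ) (i : Fin N) (t : Fin T) :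
    Set.InjOn (deriv (C.v i t)) (C.dom i t) := by
  intro x hx z hz h
  have h₁ := hC.v_le_tangent hx hz
  have h₂ := hC.v_le_tangent hz hx
  rw [h] at h₁
  have : δ * (x - z) ^ 2 ≤ 0 := by nlinarith
  have : (x - z) ^ 2 ≤ 0 := by
    by_contra! hpos
    exact absurd this (not_le.2 (mul_pos hδ hpos))
  exact sub_eq_zero.1 (pow_eq_zero_iff two_ne_zero |>.1 (le_antisymm this (sq_nonneg _)))

theorem isOpen_allocDom (hC : C.Standing δ) : IsOpen C.allocDom := by
  have : C.allocDom = ⋂ i, ⋂ t, (fun x : Alloc N T => x (i, t)) ⁻¹' C.dom i t := by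
    ext; simp [allocDom]
  rw [this]
  exact isOpen_iInter_of_finite fun i => isOpen_iInter_of_finite fun t =>
    (hC.isOpen_dom i t).preimage (by fun_prop)

theorem PriceBounds.feasible_subset (hr : C.PriceBounds rlo rhi) : C.feasible ⊆ C.allocDom :=
  fun x hx i t => (hr.mem_Icc x hx i t).1

/-- Monotonicity of the gradient of the strongly concave objective. -/
theorem objectiveDeriv_sub_le (hC : C.Standing δ) (hf : StrongConcaveOn C.allocDom δ' C.objective)
    {x z : Alloc N T} (hx : x ∈ C.allocDom) (hz : z ∈ C.allocDom) :
    C.objectiveDeriv x (x - z) - C.objectiveDeriv z (x - z) ≤ -(δ' * ‖x - z‖ ^ 2) := by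
  have h₁ := hf.le_tangent hx hz (hC.hasDerivAt_objective hx _)
  have h₂ := hf.le_tangent hz hx (hC.hasDerivAt_objective hz _)
  have h₃ : C.objectiveDeriv x (z - x) = -C.objectiveDeriv x (x - z) := by
    simp only [objectiveDeriv, ← Finset.sum_neg_distrib, PiLp.sub_apply]
    exact Finset.sum_congr rfl fun i _ => Finset.sum_congr rfl fun t _ => by ring
  rw [norm_sub_rev] at h₂
  rw [h₃] at h₁
  linarith

end EnergyCommunity

/-! ### KKT conditions and strong duality -/

namespace EnergyCommunity

variable {N T L : ℕ} (C : EnergyCommunity N T L)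

/-- The Karush–Kuhn–Tucker conditions, for a price vector `π` and a demand vector `x`. -/
structure IsKKT (π : Price T L) (x : Alloc N T) : Prop where
  mem_feasible : x ∈ C.feasible
  nonneg : ∀ j, 0 ≤ π j
  sum_peak : ∑ t, π (Sum.inr t) = C.p0
  stationary : ∀ i t, deriv (C.v i t) (x (i, t)) = (C.Atildeᵀ *ᵥ π.ofLp) (i, t) + C.p t
  slack : ∀ l, π (Sum.inl l) * (C.b l - (C.A *ᵥ x.ofLp) l) = 0
  slack_peak : ∀ t, π (Sum.inr t) * (peak x - load x t) = 0

variable {C} {δ δ' : ℝ} {rlo rhi : Fin N → Fin T → ℝ} {π : Price T L} {x : Alloc N T}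

theorem objectiveDeriv_eq_inner
    (h : ∀ i t, deriv (C.v i t) (x (i, t)) = (C.Atildeᵀ *ᵥ π.ofLp) (i, t) + C.p t)
    (d : Alloc N T) : C.objectiveDeriv x d = ⟪π, C.constraintCLM d⟫ := by
  simp only [objectiveDeriv, inner_constraintCLM, h, add_sub_cancel_right]

theorem Standing.objective_le_tangent (hC : C.Standing δ) (hδ : 0 < δ) {x z : Alloc N T}
    (hx : x ∈ C.allocDom) (hz : z ∈ C.allocDom) :
    C.objective z ≤ C.objective x + C.objectiveDeriv x (z - x) := by
  simp only [objective, objectiveDeriv, ← Finset.sum_add_distrib]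
  refine Finset.sum_le_sum fun i _ => Finset.sum_le_sum fun t _ => ?_
  have h := hC.v_le_tangent (hx i t) (hz i t)
  have h' : 0 ≤ δ / 2 * (x (i, t) - z (i, t)) ^ 2 := by positivity
  simp only [PiLp.sub_apply]
  linarith

/-- Weak duality. -/
theorem le_lagrangian (hx : x ∈ C.feasible) (hπ : ∀ j, 0 ≤ π j) :
    C.objective x - C.p0 * peak x ≤ C.lagrangian π x (peak x) := by
  rw [lagrangian_eq_slack]
  have h₁ : 0 ≤ ∑ l, π (Sum.inl l) * (C.b l - (C.A *ᵥ x.ofLp) l) :=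
    Finset.sum_nonneg fun l _ => mul_nonneg (hπ _) (sub_nonneg.2 (hx l))
  have h₂ : 0 ≤ ∑ t, π (Sum.inr t) * (peak x - load x t) :=
    Finset.sum_nonneg fun t _ => mul_nonneg (hπ _) (sub_nonneg.2 (load_le_peak x t))
  linarith

/-- The Lagrangian is concave in the demand and stationary at `x`, and its `w` term vanishes, so it
is maximal at `x`, where slackness reduces it to the primal value. -/
theorem IsKKT.lagrangian_le (hC : C.Standing δ) (hδ : 0 < δ) (hr : C.PriceBounds rlo rhi)
    (h : C.IsKKT π x) {z : Alloc N T} (hz : z ∈ C.allocDom) (w : ℝ) :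
    C.lagrangian π z w ≤ C.objective x - C.p0 * peak x := by
  have h₁ : C.lagrangian π x (peak x) = C.objective x - C.p0 * peak x := by
    rw [lagrangian_eq_slack, Finset.sum_eq_zero fun l _ => h.slack l,
      Finset.sum_eq_zero fun t _ => h.slack_peak t, add_zero, add_zero]
  have h₂ := hC.objective_le_tangent hδ (hr.feasible_subset h.mem_feasible) hz
  rw [objectiveDeriv_eq_inner h.stationary, map_sub, inner_sub_right] at h₂
  rw [lagrangian_eq, h.sum_peak] at h₁ ⊢
  linarith

theorem IsKKT.dual_le (hC : C.Standing δ) (hδ : 0 < δ) (hr : C.PriceBounds rlo rhi)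
    (h : C.IsKKT π x) : C.dual π ≤ ((C.objective x - C.p0 * peak x : ℝ) : EReal) :=
  iSup₂_le fun _ hz => iSup_le fun w => EReal.coe_le_coe_iff.2 (h.lagrangian_le hC hδ hr hz w)

theorem lagrangian_le_dual (hx : x ∈ C.allocDom) (w : ℝ) :
    (C.lagrangian π x w : EReal) ≤ C.dual π :=
  le_iSup₂_of_le x hx (le_iSup_of_le w le_rfl)

theorem IsKKT.isOptimalPrice (hC : C.Standing δ) (hδ : 0 < δ) (hr : C.PriceBounds rlo rhi)
    (h : C.IsKKT π x) : C.IsOptimalPrice π :=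
  ⟨h.nonneg, fun _ hπ' => (h.dual_le hC hδ hr).trans <|
    (EReal.coe_le_coe_iff.2 (le_lagrangian h.mem_feasible hπ')).trans
      (lagrangian_le_dual (hr.feasible_subset h.mem_feasible) _)⟩

/-- Every optimal price vector satisfies the KKT conditions with the same demand. -/
theorem IsKKT.of_isOptimalPrice (hC : C.Standing δ) (hδ : 0 < δ) (hr : C.PriceBounds rlo rhi)
    (h : C.IsKKT π x) {ρ : Price T L} (hρ : C.IsOptimalPrice ρ) : C.IsKKT ρ x := by
  have hx := hr.feasible_subset h.mem_feasible
  have hle : ∀ z ∈ C.allocDom, ∀ w, C.lagrangian ρ z w ≤ C.objective x - C.p0 * peak x :=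
    fun z hz w => EReal.coe_le_coe_iff.1 <|
      (lagrangian_le_dual hz w).trans ((hρ.2 π h.nonneg).trans (h.dual_le hC hδ hr))
  have heq : C.lagrangian ρ x (peak x) = C.objective x - C.p0 * peak x :=
    le_antisymm (hle x hx _) (le_lagrangian h.mem_feasible hρ.1)
  -- The Lagrangian is affine in `w` and attains its upper bound at `peak x`; comparing with `peak x
  -- ± 1` kills the slope.
  have hsum : ∑ t, ρ (Sum.inr t) = C.p0 := by
    have h₁ := hle x hx (peak x + 1)
    have h₂ := hle x hx (peak x - 1)
    rw [lagrangian_eq] at h₁ h₂ heq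
    linarith
  have hl : ∀ l ∈ Finset.univ, 0 ≤ ρ (Sum.inl l) * (C.b l - (C.A *ᵥ x.ofLp) l) :=
    fun l _ => mul_nonneg (hρ.1 _) (sub_nonneg.2 (h.mem_feasible l))
  have ht : ∀ t ∈ Finset.univ, 0 ≤ ρ (Sum.inr t) * (peak x - load x t) :=
    fun t _ => mul_nonneg (hρ.1 _) (sub_nonneg.2 (load_le_peak x t))
  have hzero := heq
  rw [lagrangian_eq_slack] at hzero
  have hl₀ := Finset.sum_nonneg hl
  have ht₀ := Finset.sum_nonneg ht
  refine ⟨h.mem_feasible, hρ.1, hsum, ?_, fun l => ?_, fun t => ?_⟩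
  -- The direction `d` is the gradient of the Lagrangian at its maximizer `x`; the derivative along
  -- it is the sum of the squares of its entries.
  · set d : Alloc N T := WithLp.toLp 2 fun j =>
      deriv (C.v j.1 j.2) (x j) - C.p j.2 - (C.Atildeᵀ *ᵥ ρ.ofLp) j with hd
    have hder : HasDerivAt (fun ε : ℝ => C.lagrangian ρ (x + ε • d) (peak x))
        (C.objectiveDeriv x d - ⟪ρ, C.constraintCLM d⟫) 0 := by
      have h₁ := hC.hasDerivAt_objective hx d
      have h₂ : HasDerivAt (fun ε : ℝ => ⟪ρ, C.constraintCLM (x + ε • d)⟫)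
          ⟪ρ, C.constraintCLM d⟫ 0 := by
        simp only [map_add, map_smul, inner_add_right, real_inner_smul_right]
        simpa using ((hasDerivAt_id (0 : ℝ)).mul_const ⟪ρ, C.constraintCLM d⟫).const_add
          ⟪ρ, C.constraintCLM x⟫
      simp only [lagrangian_eq]
      exact ((h₁.sub h₂).add_const _).add_const _
    have hmax : IsLocalMax (fun ε : ℝ => C.lagrangian ρ (x + ε • d) (peak x)) 0 := by
      have hcont : ContinuousAt (fun ε : ℝ => x + ε • d) 0 := by fun_prop
      have hnhds : C.allocDom ∈ 𝓝 (x + (0 : ℝ) • d) := by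
        simpa using (isOpen_allocDom hC).mem_nhds hx
      filter_upwards [hcont hnhds] with ε hε
      simpa [heq] using hle _ hε (peak x)
    have hz := hmax.hasDerivAt_eq_zero hder
    rw [inner_constraintCLM, objectiveDeriv, ← Finset.sum_sub_distrib] at hz
    simp only [← Finset.sum_sub_distrib, ← sub_mul] at hz
    have hz' : ∑ i, ∑ t, d (i, t) * d (i, t) = 0 := hz
    intro i t
    rw [Finset.sum_eq_zero_iff_of_nonneg
      fun i _ => Finset.sum_nonneg fun t _ => mul_self_nonneg _] at hz'
    have h₁ := hz' i (Finset.mem_univ i)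
    rw [Finset.sum_eq_zero_iff_of_nonneg fun t _ => mul_self_nonneg _] at h₁
    have h₂ : deriv (C.v i t) (x (i, t)) - C.p t - (C.Atildeᵀ *ᵥ ρ.ofLp) (i, t) = 0 :=
      mul_self_eq_zero.1 (h₁ t (Finset.mem_univ t))
    linarith
  · exact (Finset.sum_eq_zero_iff_of_nonneg hl).1 (by linarith) l (Finset.mem_univ l)
  · exact (Finset.sum_eq_zero_iff_of_nonneg ht).1 (by linarith) t (Finset.mem_univ t)

theorem Standing.isCompact_feasible (hC : C.Standing δ) : IsCompact C.feasible := by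
  refine Metric.isCompact_of_isClosed_isBounded ?_ hC.bounded
  have : C.feasible = ⋂ l, {x | C.constraintCLM x (Sum.inl l) ≤ C.b l} := by
    ext; simp [feasible, constraintCLM_inl]
  rw [this]
  exact isClosed_iInter fun l => isClosed_le (by fun_prop) continuous_const

theorem Standing.exists_isMaxOn (hC : C.Standing δ) (hr : C.PriceBounds rlo rhi) (hT : 1 ≤ T) :
    ∃ x ∈ C.feasible, ∀ z ∈ C.feasible,
      C.objective z - C.p0 * peak z ≤ C.objective x - C.p0 * peak x := by
  have hne : (0 : Alloc N T) ∈ C.feasible := fun l => by simpa using hC.b_nonneg l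
  have hcont : ContinuousOn C.objective C.feasible := by
    unfold objective
    refine continuousOn_finsetSum _ fun i _ => continuousOn_finsetSum _ fun t _ => ?_
    refine ContinuousOn.sub ?_ (by fun_prop)
    exact (hC.differentiable i t).continuousOn.comp (by fun_prop)
      fun x hx => hr.feasible_subset hx i t
  exact hC.isCompact_feasible.exists_isMaxOn ⟨0, hne⟩
    (hcont.sub ((continuous_peak hT).continuousOn.const_mul C.p0))

variable (C) in
/-- `objectiveDeriv` as a linear functional of the direction. -/
noncomputable def objectiveDerivLinear (x : Alloc N T) : Alloc N T →ₗ[ℝ] ℝ where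
  toFun := C.objectiveDeriv x
  map_add' d e := by
    simp only [objectiveDeriv, ← Finset.sum_add_distrib, PiLp.add_apply, mul_add]
  map_smul' a d := by
    simp only [objectiveDeriv, Finset.mul_sum, PiLp.smul_apply, smul_eq_mul, RingHom.id_apply]
    exact Finset.sum_congr rfl fun i _ => Finset.sum_congr rfl fun t _ => by ring

/-- The constraints are affine, so no qualification is needed: every direction allowed by the active
constraints at `(x, peak x)` is feasible for short steps, hence cannot improve the objective.
Farkas' lemma turns this into multipliers. -/
theorem Standing.exists_isKKT (hC : C.Standing δ) (hr : C.PriceBounds rlo rhi) (hT : 1 ≤ T)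
    (hp : 0 ≤ C.p0) : ∃ (π : Price T L) (x : Alloc N T), C.IsKKT π x := by
  classical
  obtain ⟨x, hx, hmax⟩ := hC.exists_isMaxOn hr hT
  -- Coefficient of `w` in each stacked constraint: 0 for the rows of `A`, 1 for the peak rows.
  let e : Fin L ⊕ Fin T → ℝ := Sum.elim 0 1
  let a : Fin L ⊕ Fin T → (Alloc N T × ℝ) →ₗ[ℝ] ℝ := fun j =>
    (EuclideanSpace.proj j : Price T L →L[ℝ] ℝ).toLinearMap ∘ₗ
      C.constraintCLM.toLinearMap ∘ₗ LinearMap.fst ℝ _ _ - e j • LinearMap.snd ℝ _ _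
  let c : (Alloc N T × ℝ) →ₗ[ℝ] ℝ :=
    C.objectiveDerivLinear x ∘ₗ LinearMap.fst ℝ _ _ - C.p0 • LinearMap.snd ℝ _ _
  let s : Finset (Fin L ⊕ Fin T) := Finset.univ.filter fun j =>
    C.constraintCLM x j = C.bound j + e j * peak x
  have ha : ∀ j d w, a j (d, w) = C.constraintCLM d j - e j * w := fun j d w => by simp [a]
  have hc : ∀ d w, c (d, w) = C.objectiveDeriv x d - C.p0 * w := fun d w => by
    simp [c, objectiveDerivLinear]
  have hconstr : ∀ (z : Alloc N T) (w : ℝ),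
      (∀ j, C.constraintCLM z j ≤ C.bound j + e j * w) ↔ z ∈ C.feasible ∧ ∀ t, load z t ≤ w := by
    intro z w
    simp [Sum.forall, constraintCLM_inl, constraintCLM_inr, bound, e, feasible]
  have hfirst : ∀ d, (∀ j ∈ s, a j d ≤ 0) → c d ≤ 0 := by
    rintro ⟨d, w⟩ hd
    have hev : ∀ᶠ ε in 𝓝[>] (0 : ℝ), ∀ j,
        C.constraintCLM (x + ε • d) j ≤ C.bound j + e j * (peak x + ε * w) := by
      rw [eventually_all]
      intro j
      -- Active constraints do not increase along the direction; inactive ones stay strict by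
      -- continuity.
      by_cases hj : j ∈ s
      · filter_upwards [self_mem_nhdsWithin] with ε hε
        have h₁ := hd j hj
        rw [ha] at h₁
        have h₂ := (Finset.mem_filter.1 hj).2
        simp only [map_add, map_smul, PiLp.add_apply, PiLp.smul_apply, smul_eq_mul]
        nlinarith [mul_nonneg (le_of_lt hε) (neg_nonneg.2 h₁)]
      · have hlt : C.constraintCLM x j < C.bound j + e j * peak x := by
          refine lt_of_le_of_ne ((hconstr x (peak x)).2 ⟨hx, load_le_peak x⟩ j) fun h => hj ?_
          exact Finset.mem_filter.2 ⟨Finset.mem_univ _, h⟩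
        have hlim₁ : ContinuousAt (fun ε : ℝ => C.constraintCLM (x + ε • d) j) 0 := by fun_prop
        have hlim₂ : ContinuousAt (fun ε : ℝ => C.bound j + e j * (peak x + ε * w)) 0 := by
          fun_prop
        have := hlim₁.eventually_lt hlim₂ (by simpa using hlt)
        exact (this.filter_mono nhdsWithin_le_nhds).mono fun ε h => h.le
    have hx' := hr.feasible_subset hx
    have hlim := (hC.hasDerivAt_objective hx' d).tendsto_slope_zero_right
    have hle : C.objectiveDeriv x d ≤ C.p0 * w := by
      refine le_of_tendsto hlim ?_
      filter_upwards [hev, self_mem_nhdsWithin] with ε hε hε0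
      obtain ⟨hfeas, hload⟩ := (hconstr _ _).1 hε
      have h₁ := hmax _ hfeas
      have h₂ := mul_le_mul_of_nonneg_left (peak_le hT hload) hp
      simp only [zero_add, zero_smul, add_zero, smul_eq_mul]
      rw [inv_mul_eq_div, div_le_iff₀ hε0]
      linarith
    rw [hc]
    linarith
  obtain ⟨r, hr0, hrs, hcr⟩ := farkas_of_finset s a c hfirst
  have hcr' : ∀ d w, C.objectiveDeriv x d - C.p0 * w
      = ∑ j, r j * (C.constraintCLM d j - e j * w) := by
    intro d w
    rw [← hc, hcr]
    simp only [LinearMap.coe_sum, Finset.sum_apply, LinearMap.smul_apply, ha, smul_eq_mul]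
    exact Finset.sum_subset (Finset.subset_univ _) fun j _ hj => by rw [hrs j hj, zero_mul]
  have hslack : ∀ j, r j * (C.bound j + e j * peak x - C.constraintCLM x j) = 0 := by
    intro j
    by_cases hj : j ∈ s
    · rw [(Finset.mem_filter.1 hj).2, sub_self, mul_zero]
    · rw [hrs j hj, zero_mul]
  -- The multiplier identity in the pure `w` direction gives the peak price sum, and in the unit
  -- demand directions it gives stationarity.
  refine ⟨WithLp.toLp 2 r, x, hx, hr0, ?_, fun i t => ?_, fun l => ?_, fun t => ?_⟩
  · have := hcr' 0 1
    simp [objectiveDeriv, e] at this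
    simpa using this.symm
  · have h₁ := hcr' (EuclideanSpace.single (i, t) 1) 0
    have h₂ := inner_constraintCLM C (WithLp.toLp 2 r) (EuclideanSpace.single (i, t) 1)
    rw [PiLp.inner_apply] at h₂
    have h₃ : ∀ g : Fin N → Fin T → ℝ, ∑ i', ∑ t', g i' t' *
        (EuclideanSpace.single (i, t) (1 : ℝ) : Alloc N T) (i', t') = g i t := by
      intro g
      rw [Finset.sum_eq_single i, Finset.sum_eq_single t]
      · simp
      · intro t' _ ht'; simp [ht']
      · simp
      · intro i' _ hi'; exact Finset.sum_eq_zero fun t' _ => by simp [hi']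
      · simp
    rw [h₃ fun i t => (C.Atildeᵀ *ᵥ (WithLp.toLp 2 r).ofLp) (i, t)] at h₂
    rw [objectiveDeriv, h₃ fun i t => deriv (C.v i t) (x (i, t)) - C.p t] at h₁
    rw [← h₂, ← sub_eq_iff_eq_add]
    simpa [mul_comm] using h₁
  · simpa [constraintCLM_inl, bound, e] using hslack (Sum.inl l)
  · simpa [constraintCLM_inr, bound, e] using hslack (Sum.inr t)

end EnergyCommunity

/-! ### Demand as a function of price, and the variational inequality -/

namespace EnergyCommunity

variable {N T L : ℕ} (C : EnergyCommunity N T L)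

/-- The demands of all users under the price vector `π`. -/
noncomputable def demandVec (π : Price T L) : Alloc N T :=
  WithLp.toLp 2 fun j => C.demandAt π j.1 j.2

/-- The projected gradient iterates of the common price vector. -/
noncomputable def priceSeq (P : Set (Price T L)) (α : ℝ) (π₀ : Price T L) : ℕ → Price T L
  | 0 => π₀
  | k + 1 => euclideanProj P (priceSeq P α π₀ k
      - α • (C.bound - C.constraintCLM (C.demandVec (priceSeq P α π₀ k))))

variable {C} {δ δ' : ℝ} {rlo rhi : Fin N → Fin T → ℝ} {π : Price T L} {x : Alloc N T}

/-- Proper prices keep each aggregated price within the attained marginal utilities, so `invFunOn`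
is a genuine inverse there. -/
theorem demandVec_spec (hr : C.PriceBounds rlo rhi) (hπ : π ∈ C.properPrices rlo rhi) :
    C.demandVec π ∈ C.allocDom ∧ ∀ i t, deriv (C.v i t) (C.demandVec π (i, t))
      = (C.Atildeᵀ *ᵥ π.ofLp) (i, t) + C.p t := by
  have hex : ∀ i t, ∃ z ∈ C.dom i t, deriv (C.v i t) z
      = C.p t + ∑ l, C.A l (i, t) * π (Sum.inl l) + π (Sum.inr t) := fun i t => by
    have := hr.exists_eq i t _ (hπ.2.1 i t)
    rwa [transpose_mulVec_apply, add_comm, ← add_assoc] at this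
  refine ⟨fun i t => Function.invFunOn_mem (hex i t), fun i t => ?_⟩
  rw [transpose_mulVec_apply, add_comm, ← add_assoc]
  exact Function.invFunOn_eq (hex i t)

theorem IsKKT.mem_properPrices (hr : C.PriceBounds rlo rhi) (h : C.IsKKT π x) :
    π ∈ C.properPrices rlo rhi :=
  ⟨h.nonneg, fun i t => h.stationary i t ▸ (hr.mem_Icc x h.mem_feasible i t).2, h.sum_peak⟩

theorem IsKKT.demandVec_eq (hC : C.Standing δ) (hδ : 0 < δ) (hr : C.PriceBounds rlo rhi)
    (h : C.IsKKT π x) : C.demandVec π = x := by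
  obtain ⟨h₁, h₂⟩ := demandVec_spec hr (h.mem_properPrices hr)
  ext ⟨i, t⟩
  exact hC.injOn_deriv hδ i t (h₁ i t) (hr.feasible_subset h.mem_feasible i t)
    ((h₂ i t).trans (h.stationary i t).symm)

theorem isClosed_properPrices : IsClosed (C.properPrices rlo rhi) := by
  have : C.properPrices rlo rhi = (⋂ j, {π : Price T L | 0 ≤ π j}) ∩
      ((⋂ i, ⋂ t, {π : Price T L | ∑ l, C.A l (i, t) * π (Sum.inl l) + π (Sum.inr t) + C.p t ∈
        Set.Icc (rlo i t) (rhi i t)}) ∩ {π : Price T L | ∑ t, π (Sum.inr t) = C.p0}) := by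
    ext; simp only [properPrices, transpose_mulVec_apply, Set.mem_ofPred_eq, Set.mem_inter_iff,
      Set.mem_iInter]
  rw [this]
  refine (isClosed_iInter fun j => isClosed_le continuous_const (by fun_prop)).inter
    ((isClosed_iInter fun i => isClosed_iInter fun t => isClosed_Icc.preimage ?_).inter
      (isClosed_eq ?_ continuous_const)) <;> fun_prop

theorem convex_properPrices : Convex ℝ (C.properPrices rlo rhi) := by
  rintro π ⟨h₁, h₂, h₃⟩ ρ ⟨k₁, k₂, k₃⟩ a b ha hb hab
  refine ⟨fun j => ?_, fun i t => ?_, ?_⟩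
  · exact add_nonneg (mul_nonneg ha (h₁ j)) (mul_nonneg hb (k₁ j))
  · have := convex_Icc (rlo i t) (rhi i t) (h₂ i t) (k₂ i t) ha hb hab
    convert this using 1
    simp only [WithLp.ofLp_add, WithLp.ofLp_smul, Matrix.mulVec_add, Matrix.mulVec_smul,
      Pi.add_apply, Pi.smul_apply, smul_eq_mul]
    linear_combination -C.p t * hab
  · simp only [PiLp.add_apply, PiLp.smul_apply, smul_eq_mul, Finset.sum_add_distrib,
      ← Finset.mul_sum, h₃, k₃, ← add_mul, hab, one_mul]

/-- Cocoercivity of the demand as a function of the price. -/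
theorem inner_demandVec_sub_le (hC : C.Standing δ) (hr : C.PriceBounds rlo rhi)
    (hf : StrongConcaveOn C.allocDom δ' C.objective) {π ρ : Price T L}
    (hπ : π ∈ C.properPrices rlo rhi) (hρ : ρ ∈ C.properPrices rlo rhi) :
    ⟪C.constraintCLM (C.demandVec π - C.demandVec ρ), π - ρ⟫
      ≤ -(δ' * ‖C.demandVec π - C.demandVec ρ‖ ^ 2) := by
  obtain ⟨h₁, h₂⟩ := demandVec_spec hr hπ
  obtain ⟨k₁, k₂⟩ := demandVec_spec hr hρ
  have h := objectiveDeriv_sub_le hC hf h₁ k₁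
  rwa [objectiveDeriv_eq_inner h₂, objectiveDeriv_eq_inner k₂, ← inner_sub_left,
    real_inner_comm] at h

/-- The pairing of the constraint slacks with prices of total peak price `p0`. -/
theorem inner_bound_sub (hsum : ∑ t, π (Sum.inr t) = C.p0) :
    ⟪C.bound - C.constraintCLM x, π⟫ = ∑ l, π (Sum.inl l) * (C.b l - (C.A *ᵥ x.ofLp) l)
      + ∑ t, π (Sum.inr t) * (peak x - load x t) - C.p0 * peak x := by
  rw [real_inner_comm, inner_price]
  simp only [PiLp.sub_apply, constraintCLM_inl, constraintCLM_inr, bound, Sum.elim_inl,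
    Sum.elim_inr, Pi.zero_apply, mul_sub, Finset.sum_sub_distrib, ← Finset.sum_mul, hsum]
  simp only [mul_zero]
  ring

theorem IsKKT.variational (h : C.IsKKT π x) {ρ : Price T L}
    (hρ : ρ ∈ C.properPrices rlo rhi) : 0 ≤ ⟪C.bound - C.constraintCLM x, ρ - π⟫ := by
  rw [inner_sub_right, inner_bound_sub hρ.2.2, inner_bound_sub h.sum_peak,
    Finset.sum_eq_zero fun l _ => h.slack l, Finset.sum_eq_zero fun t _ => h.slack_peak t]
  have h₁ : 0 ≤ ∑ l, ρ (Sum.inl l) * (C.b l - (C.A *ᵥ x.ofLp) l) :=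
    Finset.sum_nonneg fun l _ => mul_nonneg (hρ.1 _) (sub_nonneg.2 (h.mem_feasible l))
  have h₂ : 0 ≤ ∑ t, ρ (Sum.inr t) * (peak x - load x t) :=
    Finset.sum_nonneg fun t _ => mul_nonneg (hρ.1 _) (sub_nonneg.2 (load_le_peak x t))
  linarith

/-- Both slack sums of `ρ` are nonnegative, and the inequality bounds their total by that of `π`,
which is zero. Each term then vanishes. -/
theorem IsKKT.of_variational (hr : C.PriceBounds rlo rhi) (h : C.IsKKT π x) {ρ : Price T L}
    (hρ : ρ ∈ C.properPrices rlo rhi) (hx : C.demandVec ρ = x)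
    (hle : 0 ≤ ⟪C.bound - C.constraintCLM x, π - ρ⟫) : C.IsKKT ρ x := by
  rw [inner_sub_right, inner_bound_sub hρ.2.2, inner_bound_sub h.sum_peak,
    Finset.sum_eq_zero fun l _ => h.slack l, Finset.sum_eq_zero fun t _ => h.slack_peak t] at hle
  have hl : ∀ l ∈ Finset.univ, 0 ≤ ρ (Sum.inl l) * (C.b l - (C.A *ᵥ x.ofLp) l) :=
    fun l _ => mul_nonneg (hρ.1 _) (sub_nonneg.2 (h.mem_feasible l))
  have ht : ∀ t ∈ Finset.univ, 0 ≤ ρ (Sum.inr t) * (peak x - load x t) :=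
    fun t _ => mul_nonneg (hρ.1 _) (sub_nonneg.2 (load_le_peak x t))
  have hl₀ := Finset.sum_nonneg hl
  have ht₀ := Finset.sum_nonneg ht
  exact ⟨h.mem_feasible, hρ.1, hρ.2.2, hx ▸ (demandVec_spec hr hρ).2,
    fun l => (Finset.sum_eq_zero_iff_of_nonneg hl).1 (by linarith) l (Finset.mem_univ l),
    fun t => (Finset.sum_eq_zero_iff_of_nonneg ht).1 (by linarith) t (Finset.mem_univ t)⟩

/-! ### The learning algorithm as a projected gradient method -/

theorem tentativePrice_stateOf (α : ℝ) (π : Price T L) (i : Fin N) :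
    C.tentativePrice α (C.stateOf fun _ => π) i
      = π - α • (C.bound - C.constraintCLM (C.demandVec π)) := by
  ext j
  rcases j with l | t
  · simp [tentativePrice, stateOf, constraintCLM_inl, bound, demandVec, Matrix.mulVec, dotProduct,
      Fintype.sum_prod_type]
  · simp [tentativePrice, stateOf, constraintCLM_inr, bound, demandVec, load]

theorem learnLoop_eq_iterate (P : Set (Price T L)) (α : ℝ) (k : ℕ) (S : LearnState N T L) :
    C.learnLoop P α k S = (C.learnStep P α)^[k] S := by
  induction k generalizing S with
  | zero => rfl
  | succ k ih =>
    rw [learnLoop, Function.iterate_succ_apply]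
    split_ifs with h
    -- Early stopping happens only at a fixed point, where further iterations change nothing.
    · rw [h]
      exact (Function.iterate_fixed h k).symm
    · exact ih _

theorem learnRun_eq (P : Set (Price T L)) (α : ℝ) (π₀ : Price T L) (K : ℕ) :
    C.learnRun P α π₀ K = C.stateOf fun _ => C.priceSeq P α π₀ K := by
  rw [learnRun, learnLoop_eq_iterate]
  induction K with
  | zero => rfl
  | succ K ih =>
    rw [Function.iterate_succ_apply', ih, learnStep]
    simp only [tentativePrice_stateOf, priceSeq]

theorem priceSeq_spec {α : ℝ} {π₀ : Price T L} (hπ₀ : π₀ ∈ C.properPrices rlo rhi) :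
    (∀ k, C.priceSeq (C.properPrices rlo rhi) α π₀ k ∈ C.properPrices rlo rhi) ∧
    ∀ k, ∀ z ∈ C.properPrices rlo rhi,
      ⟪C.priceSeq (C.properPrices rlo rhi) α π₀ k
        - α • (C.bound
          - C.constraintCLM (C.demandVec (C.priceSeq (C.properPrices rlo rhi) α π₀ k)))
        - C.priceSeq (C.properPrices rlo rhi) α π₀ (k + 1),
        z - C.priceSeq (C.properPrices rlo rhi) α π₀ (k + 1)⟫ ≤ 0 := by
  have h := euclideanProj_spec ⟨π₀, hπ₀⟩ (isClosed_properPrices (C := C) (rlo := rlo) (rhi := rhi))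
    convex_properPrices
  refine ⟨fun k => ?_, fun k => (h _).2⟩
  cases k with
  | zero => exact hπ₀
  | succ k => exact (h _).1

end EnergyCommunity

/-! ### Nash equilibrium at a KKT point -/

namespace EnergyCommunity

variable {N T L : ℕ} {C : EnergyCommunity N T L} {δ δ' : ℝ} {rlo rhi : Fin N → Fin T → ℝ}
  {π : Price T L} {x : Alloc N T}

/-- The profile in which all users announce the prices `π`, the demands are `x`, and all proxies
are correct. -/
def profileOf (π : Price T L) (x : Alloc N T) : Profile N T L := fun i =>
  (fun t => x (i, t), fun l => π (Sum.inl l), fun t => π (Sum.inr t),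
    fun t => x (finRotate N i, t))

theorem continuous_profileOf :
    Continuous fun z : Price T L × Alloc N T => profileOf z.1 z.2 := by
  unfold profileOf
  fun_prop

theorem finRotate_ne_self (hN : 2 ≤ N) (i : Fin N) : finRotate N i ≠ i := by
  obtain ⟨n, rfl⟩ := Nat.exists_eq_add_of_le' hN
  rw [finRotate_apply]
  simp

theorem sOthers_update (hN : 2 ≤ N) (i : Fin N) (m' : Msg T L) (t : Fin T) :
    sOthers (Function.update (profileOf π x) i m') i t = π (Sum.inr t) := by
  have h : ∀ j ∈ Finset.univ.erase i,
      (Function.update (profileOf π x) i m' j).s t = π (Sum.inr t) := fun j hj => by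
    rw [Function.update_of_ne (Finset.ne_of_mem_erase hj)]; rfl
  have hN' : (2 : ℝ) ≤ N := by exact_mod_cast hN
  rw [sOthers, Finset.sum_congr rfl h, Finset.sum_const, Finset.card_erase_of_mem
    (Finset.mem_univ i), Finset.card_univ, Fintype.card_fin, nsmul_eq_mul,
    Nat.cast_sub (by omega), Nat.cast_one]
  exact mul_div_cancel_left₀ _ (by linarith)

theorem qOthers_update (hN : 2 ≤ N) (i : Fin N) (m' : Msg T L) (l : Fin L) :
    qOthers (Function.update (profileOf π x) i m') i l = π (Sum.inl l) := by
  have h : ∀ j ∈ Finset.univ.erase i,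
      (Function.update (profileOf π x) i m' j).q l = π (Sum.inl l) := fun j hj => by
    rw [Function.update_of_ne (Finset.ne_of_mem_erase hj)]; rfl
  have hN' : (2 : ℝ) ≤ N := by exact_mod_cast hN
  rw [qOthers, Finset.sum_congr rfl h, Finset.sum_const, Finset.card_erase_of_mem
    (Finset.mem_univ i), Finset.card_univ, Fintype.card_fin, nsmul_eq_mul,
    Nat.cast_sub (by omega), Nat.cast_one]
  exact mul_div_cancel_left₀ _ (by linarith)

theorem proxy_update (hN : 2 ≤ N) (i : Fin N) (m' : Msg T L) :
    proxy (Function.update (profileOf π x) i m') i = fun t => x (i, t) := by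
  have h : (finRotate N).symm i ≠ i := fun h =>
    finRotate_ne_self hN i ((Equiv.symm_apply_eq _).1 h).symm
  rw [proxy, Function.update_of_ne h]
  change (fun t => x (finRotate N ((finRotate N).symm i), t)) = _
  rw [Equiv.apply_symm_apply]

theorem y_update {i j : Fin N} (hj : j ≠ i) (m' : Msg T L) :
    (Function.update (profileOf π x) i m' j).y = fun t => x (j, t) := by
  rw [Function.update_of_ne hj]; rfl

/-- The deviator's own demand enters only through her predecessor's proxy, and for `N ≥ 2` the
predecessor is someone else, so no deviation moves `zeta`. -/
theorem zeta_update (hN : 2 ≤ N) (i : Fin N) (m' : Msg T L) :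
    zeta (Function.update (profileOf π x) i m') i = load x := by
  funext t
  rw [zeta, proxy_update hN, load, ← Finset.sum_erase_add _ _ (Finset.mem_univ i)]
  congr 1
  exact Finset.sum_congr rfl fun j hj => by rw [y_update (Finset.ne_of_mem_erase hj)]

/-- Radial normalization is the identity on peak prices summing to `p0`. If `p0 = 0`, they all
vanish, and every branch of the definition gives 0. -/
theorem radialPrice_eq (hπ : ∀ j, 0 ≤ π j) (hsum : ∑ t, π (Sum.inr t) = C.p0) (z : Fin T → ℝ)
    (t : Fin T) : C.radialPrice (fun t => π (Sum.inr t)) z t = π (Sum.inr t) := by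
  have hzero : C.p0 = 0 → ∀ t, π (Sum.inr t) = 0 := fun h0 t =>
    (Finset.sum_eq_zero_iff_of_nonneg fun t _ => hπ (Sum.inr t)).1 (hsum.trans h0) t
      (Finset.mem_univ t)
  by_cases h0 : C.p0 = 0
  · simp [radialPrice, h0, hzero h0]
  · have hne : (fun t => π (Sum.inr t)) ≠ 0 := fun h => h0 (by
      rw [← hsum]; exact Finset.sum_eq_zero fun t _ => congrFun h t)
    rw [radialPrice, if_pos hne, hsum, div_mul_cancel₀ _ h0]

/-- Everything the deviator cannot control is replaced by its agreed value, so her tax separates in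
`y`, `β`, `q` and `s`. -/
theorem tax_update (hN : 2 ≤ N) (hπ : ∀ j, 0 ≤ π j) (hsum : ∑ t, π (Sum.inr t) = C.p0)
    (i : Fin N) (m' : Msg T L) :
    C.tax (Function.update (profileOf π x) i m') i
      = ∑ t, ((C.Atildeᵀ *ᵥ π.ofLp) (i, t) + C.p t) * m'.y t
        + ∑ t, (m'.β t - x (finRotate N i, t)) ^ 2
        + ∑ l, ((m'.q l - π (Sum.inl l)) ^ 2 + m'.q l * (C.b l - (C.A *ᵥ x.ofLp) l))
        + ∑ t, ((m'.s t - π (Sum.inr t)) ^ 2 + m'.s t * (peak x - load x t)) := by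
  have hs : sOthers (Function.update (profileOf π x) i m') i = fun t => π (Sum.inr t) :=
    funext (sOthers_update hN i m')
  have hA : ∀ l, C.b l - ∑ j ∈ Finset.univ.erase i, ∑ t, C.A l (j, t) *
      (Function.update (profileOf π x) i m' j).y t - ∑ t, C.A l (i, t) * x (i, t)
      = C.b l - (C.A *ᵥ x.ofLp) l := by
    intro l
    rw [sub_sub, Matrix.mulVec, dotProduct, Fintype.sum_prod_type,
      ← Finset.sum_erase_add _ _ (Finset.mem_univ i)]
    congr 2
    exact Finset.sum_congr rfl fun j hj => by rw [y_update (Finset.ne_of_mem_erase hj)]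
  have hlin : ∑ t, (C.p t + π (Sum.inr t)) * m'.y t
      + ∑ l, π (Sum.inl l) * ∑ t, C.A l (i, t) * m'.y t
      = ∑ t, ((C.Atildeᵀ *ᵥ π.ofLp) (i, t) + C.p t) * m'.y t := by
    simp only [transpose_mulVec_apply, Finset.mul_sum]
    rw [Finset.sum_comm, ← Finset.sum_add_distrib]
    refine Finset.sum_congr rfl fun t _ => ?_
    simp only [add_mul, Finset.sum_mul]
    rw [Finset.sum_congr rfl fun l _ =>
      show π (Sum.inl l) * (C.A l (i, t) * m'.y t) = C.A l (i, t) * π (Sum.inl l) * m'.y t by ring]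
    ring
  rw [tax, hs, zeta_update hN, proxy_update hN, y_update (finRotate_ne_self hN i)]
  simp only [radialPrice_eq hπ hsum, qOthers_update hN, Function.update_self, hA, hlin, peak]

/-- At a KKT point the profile of correct announcements is a Nash equilibrium. -/
theorem IsKKT.isNash (hN : 2 ≤ N) (hC : C.Standing δ) (hδ : 0 < δ) (hr : C.PriceBounds rlo rhi)
    (h : C.IsKKT π x) : C.IsNash (profileOf π x) := by
  refine ⟨fun i => ⟨fun l => h.nonneg _, fun t => h.nonneg _⟩, fun i m' hm' => ?_⟩
  have hx := hr.feasible_subset h.mem_feasible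
  have hself : C.tax (profileOf π x) i
      = ∑ t, ((C.Atildeᵀ *ᵥ π.ofLp) (i, t) + C.p t) * x (i, t) := by
    have := tax_update (x := x) hN h.nonneg h.sum_peak i (profileOf π x i)
    rw [Function.update_eq_self] at this
    rw [this]
    simp [profileOf, Msg.y, Msg.q, Msg.s, Msg.β, h.slack, h.slack_peak]
  have hdom : ∀ t, (profileOf π x i).y t ∈ C.dom i t := fun t => hx i t
  unfold payoff
  rw [if_pos hdom, Function.update_self]
  split_ifs with hd
  · rw [EReal.coe_le_coe_iff, hself, tax_update hN h.nonneg h.sum_peak]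
    -- The three penalties are nonnegative and vanish at the agreed message. In `y`, stationarity
    -- and concavity make `x` the best response to the linear price.
    have h₁ : 0 ≤ ∑ t, (m'.β t - x (finRotate N i, t)) ^ 2 :=
      Finset.sum_nonneg fun t _ => sq_nonneg _
    have h₂ : 0 ≤ ∑ l, ((m'.q l - π (Sum.inl l)) ^ 2
        + m'.q l * (C.b l - (C.A *ᵥ x.ofLp) l)) :=
      Finset.sum_nonneg fun l _ => add_nonneg (sq_nonneg _)
        (mul_nonneg (hm'.1 l) (sub_nonneg.2 (h.mem_feasible l)))
    have h₃ : 0 ≤ ∑ t, ((m'.s t - π (Sum.inr t)) ^ 2 + m'.s t * (peak x - load x t)) :=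
      Finset.sum_nonneg fun t _ => add_nonneg (sq_nonneg _)
        (mul_nonneg (hm'.2 t) (sub_nonneg.2 (load_le_peak x t)))
    have h₄ : ∑ t, C.v i t (m'.y t) - ∑ t, ((C.Atildeᵀ *ᵥ π.ofLp) (i, t) + C.p t) * m'.y t
        ≤ ∑ t, C.v i t (x (i, t))
          - ∑ t, ((C.Atildeᵀ *ᵥ π.ofLp) (i, t) + C.p t) * x (i, t) := by
      simp only [← Finset.sum_sub_distrib]
      refine Finset.sum_le_sum fun t _ => ?_
      have h₅ := hC.v_le_tangent (hx i t) (hd t)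
      rw [h.stationary i t] at h₅
      have h₆ : 0 ≤ δ / 2 * (x (i, t) - m'.y t) ^ 2 := by positivity
      linarith
    have h₇ : ∑ t, C.v i t ((profileOf π x i).y t) = ∑ t, C.v i t (x (i, t)) := rfl
    linarith
  · exact bot_le

end EnergyCommunity

/-! ### Convergence of the learning algorithm -/

theorem theorem6 {N T L : ℕ} (hN : 2 ≤ N) (hT : 1 ≤ T) (C : EnergyCommunity N T L)
    (δ : ℝ) (hδ : 0 < δ) (hC : C.Standing δ)
    (rlo rhi : Fin N → Fin T → ℝ) (hr : C.PriceBounds rlo rhi)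
    (δ' : ℝ) (hδ' : 0 < δ') (hf : StrongConcaveOn C.allocDom δ' C.objective)
    (α : ℝ) (hα : 0 < α) (hα' : α < 2 * δ' / C.normAtilde ^ 2)
    (π₀ : Price T L) (hπ₀ : π₀ ∈ C.properPrices rlo rhi) :
    (∀ π : Price T L, C.IsOptimalPrice π → ∀ i : Fin N,
      Antitone fun K : ℕ =>
        dist ((C.learnRun (C.properPrices rlo rhi) α π₀ K).price i) π) ∧
    ∃ (m : Profile N T L) (π : Price T L), C.IsNash m ∧ C.IsOptimalPrice π ∧
      (∀ i, (∀ l, (m i).q l = π (Sum.inl l)) ∧ ∀ t, (m i).s t = π (Sum.inr t)) ∧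
      Filter.Tendsto (C.learnProfile (C.properPrices rlo rhi) α π₀) Filter.atTop (nhds m) := by
  have hp : 0 ≤ C.p0 := hπ₀.2.2 ▸ Finset.sum_nonneg fun t _ => hπ₀.1 (Sum.inr t)
  obtain ⟨w, x, hw⟩ := hC.exists_isKKT hr hT hp
  obtain ⟨hmem, hproj⟩ := C.priceSeq_spec (α := α) hπ₀
  have hstep : α * ‖C.constraintCLM‖ ^ 2 < 2 * δ' := by
    -- Division by zero yields 0, so a vanishing norm would turn the step-size bound into `α < 0`.
    rcases eq_or_ne C.normAtilde 0 with h0 | h0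
    · rw [h0] at hα'
      norm_num at hα'
      linarith
    · exact (lt_div_iff₀ (by positivity)).1 hα'
  have hmono := fun π hπ ρ hρ =>
    EnergyCommunity.inner_demandVec_sub_le (π := π) (ρ := ρ) hC hr hf hπ hρ
  refine ⟨fun π hπ i => ?_, ?_⟩
  -- Any optimal price shares the demand `x` and solves the variational inequality, so the one-step
  -- distance estimate applies to it.
  · have hk := hw.of_isOptimalPrice hC hδ hr hπ
    have hd := hk.demandVec_eq hC hδ hr
    refine antitone_nat_of_succ_le fun k => ?_
    simp only [EnergyCommunity.learnRun_eq, EnergyCommunity.stateOf, dist_eq_norm]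
    have h := projectedGradient_dist_sq_le (c := C.bound) (y := C.demandVec) hα
      (hmono _ (hmem k) _ (hk.mem_properPrices hr)) (hproj k π (hk.mem_properPrices hr))
      (hd.symm ▸ hk.variational (hmem (k + 1)))
    refine le_of_sq_le_sq (h.trans (sub_le_self _ ?_)) (norm_nonneg _)
    exact mul_nonneg (mul_nonneg hα.le (by linarith)) (sq_nonneg _)
  · obtain ⟨a, haP, hya, hvi, hlim, hylim⟩ := projectedGradient_tendsto (c := C.bound)
      (y := C.demandVec) EnergyCommunity.isClosed_properPrices hα hδ' hstep hmono hmem hproj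
      (hw.mem_properPrices hr)
      (fun z hz => (hw.demandVec_eq hC hδ hr).symm ▸ hw.variational hz)
    have hax : C.demandVec a = x := hya.trans (hw.demandVec_eq hC hδ hr)
    have ha : C.IsKKT a x := hw.of_variational hr haP hax (hax ▸ hvi w (hw.mem_properPrices hr))
    refine ⟨EnergyCommunity.profileOf a x, a, ha.isNash hN hC hδ hr,
      ha.isOptimalPrice hC hδ hr, fun i => ⟨fun _ => rfl, fun _ => rfl⟩, ?_⟩
    have hprofile : C.learnProfile (C.properPrices rlo rhi) α π₀ = fun K =>
        EnergyCommunity.profileOf (C.priceSeq (C.properPrices rlo rhi) α π₀ K)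
          (C.demandVec (C.priceSeq (C.properPrices rlo rhi) α π₀ K)) := by
      funext K i
      rw [EnergyCommunity.learnProfile, EnergyCommunity.learnRun_eq]
      rfl
    rw [hprofile]
    exact (EnergyCommunity.continuous_profileOf.tendsto (a, x)).comp
      (hlim.prodMk_nhds (hax ▸ hylim))
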